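/- Theorem 2.5. Let $r$ be a natural number, let $a,b\in\mathbb{Z}$ be such that $F(x)=x^{2^r}+ax+b\in\mathbb{Z}[x]$ is irreducible, and let $K=\mathbb{Q}(\theta)$ be a number field generated by a root $\theta$ of $F$, with ring of integers $\mathbb{Z}_K$. Suppose that one of the following conditions holds: (1) $r\ge 3$, $a\equiv 4 \pmod 8$ and $b\equiv 3\pmod 8$; (2) $r\ge 4$, $a\equiv 8 \pmod{16}$ and $b\equiv 7\pmod{16}$; (3) $r\ge 4$ and either $a\equiv 0$, $b\equiv 31\pmod{32}$, or $a\equiv 16$, $b\equiv 15 \pmod{32}$. Then $2$ is a common index divisor of $K$, that is, $2$ divides the field index $i(K)=\gcd\{(\mathbb{Z}_K:\mathbb{Z}[\eta]) \mid \eta\in\mathbb{Z}_K,\ K=\mathbb{Q}(\eta)\}$; and $K$ is not monogenic, that is, there is no $\eta\in\mathbb{Z}_K$ with $\mathbb{Z}_K=\mathbb{Z}[\eta]$. -/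

import Mathlib

open NumberField Polynomial

noncomputable section

/-- `K` is monogenic: its ring of integers equals `ℤ[η]` for some `η` in it. -/
def IsMonogenic (K : Type*) [Field K] [NumberField K] : Prop :=
  ∃ η : 𝓞 K, Algebra.adjoin ℤ {η} = ⊤

/-- The index `(ℤ_K : ℤ[η])` of additive groups, for an algebraic integer `η` of `K`
(finite, hence a positive integer, whenever `K = ℚ(η)`). -/
def elementIndex {K : Type*} [Field K] [NumberField K] (η : 𝓞 K) : ℕ :=
  (Subalgebra.toSubmodule (Algebra.adjoin ℤ {η})).toAddSubgroup.index

/-- The set of all indices `(ℤ_K : ℤ[η])` with `η ∈ ℤ_K` and `K = ℚ(η)`. -/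
def indexSet (K : Type*) [Field K] [NumberField K] : Set ℕ :=
  {n | ∃ η : 𝓞 K, IntermediateField.adjoin ℚ {(η : K)} = ⊤ ∧ n = elementIndex η}

/-- The greatest common divisor of a set of natural numbers: the largest of its common divisors
(and `0` if every natural number is a common divisor). -/
def setGcd (S : Set ℕ) : ℕ :=
  sSup {d | ∀ n ∈ S, d ∣ n}

/-- `setGcd` has the universal property of the greatest common divisor, for every set. -/
theorem dvd_setGcd_iff (S : Set ℕ) (d : ℕ) : d ∣ setGcd S ↔ ∀ n ∈ S, d ∣ n := by
  by_cases h : ∃ m ∈ S, m ≠ 0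
  · obtain ⟨m, hm, hm0⟩ := h
    have hb : BddAbove {d | ∀ n ∈ S, d ∣ n} :=
      ⟨m, fun e he => Nat.le_of_dvd (Nat.pos_of_ne_zero hm0) (he m hm)⟩
    have hne : {d | ∀ n ∈ S, d ∣ n}.Nonempty := ⟨1, fun n _ => one_dvd n⟩
    have hg : ∀ n ∈ S, setGcd S ∣ n := Nat.sSup_mem hne hb
    refine ⟨fun hd n hn => hd.trans (hg n hn), fun hd => ?_⟩
    have hl : Nat.lcm (setGcd S) d ≤ setGcd S :=
      le_csSup hb fun n hn => Nat.lcm_dvd (hg n hn) (hd n hn)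
    have hpos : 0 < setGcd S := Nat.pos_of_dvd_of_pos (hg m hm) (Nat.pos_of_ne_zero hm0)
    have hle : setGcd S ≤ Nat.lcm (setGcd S) d :=
      Nat.le_of_dvd (Nat.pos_of_ne_zero fun h0 => by
        rcases Nat.lcm_eq_zero_iff.mp h0 with h1 | h1
        · omega
        · have := hd m hm
          rw [h1, zero_dvd_iff] at this
          exact hm0 this) (Nat.dvd_lcm_left _ _)
    have := Nat.dvd_lcm_right (setGcd S) d
    rwa [le_antisymm hl hle] at this
  · push Not at h
    have hS : {d : ℕ | ∀ n ∈ S, d ∣ n} = Set.univ := by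
      ext e
      simp only [Set.mem_ofPred_eq, Set.mem_univ, iff_true]
      intro n hn
      rw [h n hn]
      exact dvd_zero e
    have h0 : setGcd S = 0 := by
      unfold setGcd
      rw [hS]
      exact Nat.sSup_of_not_bddAbove not_bddAbove_univ
    rw [h0]
    exact ⟨fun _ n hn => by rw [h n hn]; exact dvd_zero d, fun _ => dvd_zero d⟩

/-- The index `i(K) = gcd {(ℤ_K : ℤ[η]) | η ∈ ℤ_K, K = ℚ(η)}` of the number field `K`. -/
def fieldIndex (K : Type*) [Field K] [NumberField K] : ℕ :=
  setGcd (indexSet K)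

/-- `p` is a prime common index divisor of `K`: a prime dividing `i(K)`. -/
def IsCommonIndexDivisor (p : ℕ) (K : Type*) [Field K] [NumberField K] : Prop :=
  p.Prime ∧ p ∣ fieldIndex K

end

/-!
An element `η` of a ring has at most two residues at a prime with residue field `𝔽₂`. If a Dedekind
domain has three such primes, then `η` has the same residue at two of them, hence so does every
element of `ℤ[η]`; this is impossible when `ℤ[η]` has odd index, since the two primes would then
coincide (`two_dvd_index_adjoin`). So it suffices to find three primes of norm `2` in `𝓞 K`.

They come from the Newton polygon of `F(x + 1)` at `2`, which is dealt with as follows. Over the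
algebraic closure of `ℚ₂`, a polynomial whose value at `t` is smaller than one of its terms on the
disc of radius `|t|` has a root of absolute value `|t|` (`exists_root_norm_eq`). Write
`2 ^ r = 2 ^ (m + s)`. For `t ^ 2 ^ m = 2`, or `t ^ (2 ^ m - 1) = 2`, the value of `F(x + 1)` at `t`
is estimated by repeated squaring of `1 + t`, and is compared with the term of degree `2 ^ m`. This
gives roots `ρ` with `|ρ| ^ d = 1 / 2`, where `d` is the width of an edge of height one. In the same
way there is a root to the left of these edges.

Each root gives an embedding of `K` into the algebraic closure of `ℚ₂`, which maps `θ - 1` to it,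
and a prime of `𝓞 K`, the centre of the induced absolute value. The equality `|ρ| ^ d = 1 / 2` forces
this prime to have ramification index at least `d` (`two_mem_centre_pow`), and roots with distinct
absolute values have distinct centres (`norm_eq_of_centre_eq`). As `∑ e f` is the degree, and the
widths leave no room for a residue degree `2`, three of the primes have norm `2` (`absNorm_eq_two`).
The existence of roots is thus all that is needed from the theory of Newton polygons; the number of
roots on each edge is not.
-/

/-! ### Roots of prescribed absolute value -/

theorem IsUltrametricDist.norm_add_lt_of_lt {L : Type*} [SeminormedAddCommGroup L]
    [IsUltrametricDist L] {x y : L} {c : ℝ} (hx : ‖x‖ < c) (hy : ‖y‖ < c) : ‖x + y‖ < c :=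
  (IsUltrametricDist.norm_add_le_max x y).trans_lt (max_lt hx hy)

theorem IsUltrametricDist.norm_add_le_of_le {L : Type*} [SeminormedAddCommGroup L]
    [IsUltrametricDist L] {x y : L} {c : ℝ} (hx : ‖x‖ ≤ c) (hy : ‖y‖ ≤ c) : ‖x + y‖ ≤ c :=
  (IsUltrametricDist.norm_add_le_max x y).trans (max_le hx hy)

/-- One half of the multiplicativity of the Gauss norm, for a product of linear factors. -/
theorem norm_coeff_prod_X_sub_C_mul_pow_le {L : Type*} [NormedField L] [IsUltrametricDist L]
    {μ : ℝ} (hμ : 0 ≤ μ) (s : Multiset L) (k : ℕ) :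
    ‖((s.map fun ρ => X - C ρ).prod).coeff k‖ * μ ^ k ≤ (s.map fun ρ => max μ ‖ρ‖).prod := by
  induction s using Multiset.induction_on generalizing k with
  | empty =>
    rcases k with _ | k
    · simp
    · simp [coeff_one]
  | cons ρ s ih =>
    simp only [Multiset.map_cons, Multiset.prod_cons]
    set g := (s.map fun ρ => X - C ρ).prod
    set P := (s.map fun ρ => max μ ‖ρ‖).prod
    have hρ : ‖ρ * g.coeff k‖ * μ ^ k ≤ max μ ‖ρ‖ * P := by
      rw [norm_mul, mul_assoc]
      exact mul_le_mul (le_max_right _ _) (ih k) (by positivity) (hμ.trans (le_max_left _ _))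
    rw [sub_mul, coeff_sub, coeff_C_mul]
    rcases k with _ | k
    · simpa using hρ
    · rw [coeff_X_mul]
      have h1 : ‖g.coeff k‖ * μ ^ (k + 1) ≤ max μ ‖ρ‖ * P := by
        rw [pow_succ, ← mul_assoc, mul_comm]
        exact mul_le_mul (le_max_left _ _) (ih k) (by positivity) (hμ.trans (le_max_left _ _))
      have h2 := IsUltrametricDist.norm_add_le_max (g.coeff k) (-(ρ * g.coeff (k + 1)))
      rw [norm_neg, ← sub_eq_add_neg] at h2
      calc _ ≤ max ‖g.coeff k‖ ‖ρ * g.coeff (k + 1)‖ * μ ^ (k + 1) := by gcongr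
        _ ≤ _ := by
          rw [max_mul_of_nonneg _ _ (by positivity)]
          exact max_le h1 hρ

/-- If the value of a polynomial at `t` is smaller than one of its terms on the disc of radius `μ`,
then there is a cancellation, which is caused by a root that is close to `t`. This replaces the
theory of Newton polygons. -/
theorem exists_root_norm_sub_lt {L : Type*} [NormedField L] [IsUltrametricDist L] [IsAlgClosed L]
    {f : L[X]} (hf : f.Monic) {μ : ℝ} (hμ : 0 ≤ μ) {t : L} {k : ℕ}
    (h : ‖f.eval t‖ < ‖f.coeff k‖ * μ ^ k) :
    ∃ ρ, f.eval ρ = 0 ∧ ‖t - ρ‖ < max μ ‖ρ‖ := by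
  by_contra! hn
  have hs := IsAlgClosed.splits f
  have h1 := norm_coeff_prod_X_sub_C_mul_pow_le hμ f.roots k
  rw [← hs.eq_prod_roots_of_monic hf] at h1
  refine (h.trans_le h1).not_ge ?_
  have hnorm : ‖(f.roots.map (t - ·)).prod‖ = (f.roots.map fun ρ => ‖t - ρ‖).prod := by
    simpa using map_multiset_prod (normHom (α := L)) (f.roots.map (t - ·))
  rw [hs.eval_eq_prod_roots_of_monic hf, hnorm]
  refine Multiset.prod_map_le_prod_map₀ _ _ (fun ρ _ => hμ.trans (le_max_left _ _)) fun ρ hρ => ?_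
  simpa using hn ρ (isRoot_of_mem_roots hρ)

theorem exists_root_norm_eq {L : Type*} [NormedField L] [IsUltrametricDist L] [IsAlgClosed L]
    {f : L[X]} (hf : f.Monic) {t : L} {k : ℕ} (h : ‖f.eval t‖ < ‖f.coeff k‖ * ‖t‖ ^ k) :
    ∃ ρ, f.eval ρ = 0 ∧ ‖ρ‖ = ‖t‖ := by
  obtain ⟨ρ, h0, hρ⟩ := exists_root_norm_sub_lt hf (norm_nonneg t) h
  refine ⟨ρ, h0, ?_⟩
  by_contra hne
  have hne' : ‖t‖ ≠ ‖-ρ‖ := by rw [norm_neg]; exact Ne.symm hne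
  rw [sub_eq_add_neg, IsUltrametricDist.norm_add_eq_max_of_norm_ne_norm hne', norm_neg] at hρ
  exact hρ.false

/-- The case `t = 0` of `exists_root_norm_sub_lt`. -/
theorem exists_root_norm_lt {L : Type*} [NormedField L] [IsUltrametricDist L] [IsAlgClosed L]
    {f : L[X]} (hf : f.Monic) {μ : ℝ} (hμ : 0 ≤ μ) {k : ℕ}
    (h : ‖f.eval 0‖ < ‖f.coeff k‖ * μ ^ k) :
    ∃ ρ, f.eval ρ = 0 ∧ ‖ρ‖ < μ := by
  obtain ⟨ρ, h0, hρ⟩ := exists_root_norm_sub_lt hf hμ h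
  rw [zero_sub, norm_neg, lt_max_iff] at hρ
  exact ⟨ρ, h0, hρ.resolve_right (lt_irrefl _)⟩

/-! ### The iterated squares of `1 + t` -/

section Dyadic

variable {L : Type*} [NormedField L] [IsUltrametricDist L]

theorem norm_intCast_le_of_two_pow_dvd (h2 : ‖(2 : L)‖ = 1 / 2) {k : ℕ} {c : ℤ}
    (h : (2 : ℤ) ^ k ∣ c) : ‖(c : L)‖ ≤ (1 / 2) ^ k := by
  obtain ⟨q, rfl⟩ := h
  push_cast
  rw [norm_mul, norm_pow, h2]
  exact mul_le_of_le_one_right (by positivity) (IsUltrametricDist.norm_intCast_le_one L q)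

theorem norm_natCast_eq_one_of_odd (h2 : ‖(2 : L)‖ = 1 / 2) {c : ℕ} (h : Odd c) :
    ‖(c : L)‖ = 1 := by
  refine le_antisymm (IsUltrametricDist.norm_natCast_le_one L c) ?_
  obtain ⟨q, rfl⟩ := h
  by_contra! hlt
  have h1 : ‖((2 * q + 1 : ℕ) : L) - 2 * q‖ < 1 := by
    rw [sub_eq_add_neg]
    refine IsUltrametricDist.norm_add_lt_of_lt hlt ?_
    rw [norm_neg, norm_mul, h2]
    have := IsUltrametricDist.norm_natCast_le_one L q
    linarith
  simp at h1

/-- By Kummer's theorem the valuation of this binomial coefficient is `s`. -/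
theorem pow_le_norm_choose_two_pow (h2 : ‖(2 : L)‖ = 1 / 2) (m s : ℕ) :
    (1 / 2 : ℝ) ^ s ≤ ‖((Nat.choose (2 ^ (m + s)) (2 ^ m) : ℕ) : L)‖ := by
  have hle : 2 ^ m ≤ 2 ^ (m + s) := Nat.pow_le_pow_right (by norm_num) (by omega)
  have hval := Nat.prime_two.emultiplicity_choose_prime_pow hle (by positivity)
  have hm : multiplicity 2 (2 ^ m) = m := multiplicity_pow_self_of_prime Nat.prime_two.prime m
  rw [hm, Nat.add_sub_cancel_left] at hval
  obtain ⟨q, hq⟩ := pow_dvd_of_le_emultiplicity hval.ge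
  have hodd : Odd q := by
    rw [← Nat.not_even_iff_odd]
    rintro h
    obtain ⟨w, rfl⟩ := even_iff_two_dvd.mp h
    refine not_pow_dvd_of_emultiplicity_lt (m := s + 1)
      (by rw [hval]; exact_mod_cast Nat.lt_succ_self s) ?_
    exact ⟨w, by rw [hq]; ring⟩
  rw [hq]
  push_cast
  rw [norm_mul, norm_pow, h2, norm_natCast_eq_one_of_odd h2 hodd, mul_one]

/-- Raising `1 + t` to the power `2 ^ m` is additive modulo `2t`. -/
theorem norm_one_add_pow_two_pow_sub_le (h2 : ‖(2 : L)‖ = 1 / 2) {t : L} (ht : ‖t‖ ≤ 1) (m : ℕ) :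
    ‖(1 + t) ^ 2 ^ m - 1 - t ^ 2 ^ m‖ ≤ ‖t‖ / 2 := by
  induction m with
  | zero => simpa using by positivity
  | succ m ih =>
    have hq : ‖2 * t ^ 2 ^ m‖ ≤ ‖t‖ / 2 := by
      rw [norm_mul, h2, norm_pow]
      linarith [pow_le_of_le_one (norm_nonneg t) ht (pow_ne_zero m two_ne_zero)]
    set q := t ^ 2 ^ m with hqdef
    set E := (1 + t) ^ 2 ^ m - 1 - q with hE
    have hA : (1 + t) ^ 2 ^ m = 1 + q + E := by rw [hE]; ring
    rw [show (1 + t) ^ 2 ^ (m + 1) - 1 - t ^ 2 ^ (m + 1) = 2 * q + E * (2 + (2 * q + E)) by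
      rw [pow_succ 2 m, pow_mul, pow_mul, hA, ← hqdef]; ring]
    refine IsUltrametricDist.norm_add_le_of_le hq ?_
    have h1 : ‖2 + (2 * q + E)‖ ≤ 1 :=
      IsUltrametricDist.norm_add_le_of_le (by rw [h2]; norm_num)
        (IsUltrametricDist.norm_add_le_of_le (hq.trans (by linarith)) (ih.trans (by linarith)))
    rw [norm_mul]
    exact (mul_le_of_le_one_right (norm_nonneg _) h1).trans ih

/-- For `m ≥ 2` additivity holds beyond `2t`, as the linear term `2 ^ m * t` is smaller. -/
theorem norm_one_add_pow_two_pow_sub_lt (h2 : ‖(2 : L)‖ = 1 / 2) {t : L} (ht0 : 0 < ‖t‖)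
    (ht : ‖t‖ < 1) {m : ℕ} (hm : 2 ≤ m) :
    ‖(1 + t) ^ 2 ^ m - 1 - t ^ 2 ^ m‖ < ‖t‖ / 2 := by
  obtain ⟨m, rfl⟩ := Nat.exists_eq_succ_of_ne_zero (by omega : m ≠ 0)
  have ih := norm_one_add_pow_two_pow_sub_le h2 ht.le m
  have hq : ‖2 * t ^ 2 ^ m‖ < ‖t‖ / 2 := by
    rw [norm_mul, h2, norm_pow]
    linarith [pow_lt_self_of_lt_one₀ ht0 ht (Nat.one_lt_two_pow (by omega : m ≠ 0))]
  set q := t ^ 2 ^ m with hqdef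
  set E := (1 + t) ^ 2 ^ m - 1 - q with hE
  have hA : (1 + t) ^ 2 ^ m = 1 + q + E := by rw [hE]; ring
  rw [show (1 + t) ^ 2 ^ (m + 1) - 1 - t ^ 2 ^ (m + 1) = 2 * q + E * (2 + (2 * q + E)) by
    rw [pow_succ 2 m, pow_mul, pow_mul, hA, ← hqdef]; ring]
  refine IsUltrametricDist.norm_add_lt_of_lt hq ?_
  have hle : ‖t‖ / 2 ≤ 1 / 2 := by linarith
  have h1 : ‖2 + (2 * q + E)‖ ≤ 1 / 2 :=
    IsUltrametricDist.norm_add_le_of_le h2.le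
      (IsUltrametricDist.norm_add_le_of_le (hq.le.trans hle) (ih.trans hle))
  rw [norm_mul]
  nlinarith [norm_nonneg E]

/-- The first squaring gains more than the expected factor, because `3 ^ 2 - 1 = 8`; each further one
gains a factor `2`. -/
theorem norm_pow_two_pow_sub_one_lt (h2 : ‖(2 : L)‖ = 1 / 2) {A : L} (hA : ‖A - 3‖ < 1 / 2)
    (i : ℕ) : ‖A ^ 2 ^ (i + 1) - 1‖ < (1 / 2) ^ (i + 2) := by
  have h4 : ‖(4 : L)‖ < 1 / 2 := by
    rw [show (4 : L) = 2 * 2 by norm_num, norm_mul, h2]; norm_num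
  induction i with
  | zero =>
    rw [show A ^ 2 ^ (0 + 1) - 1 = ((A - 3) + 2) * ((A - 3) + 4) by ring, norm_mul]
    have h1 : ‖A - 3 + 2‖ ≤ 1 / 2 := IsUltrametricDist.norm_add_le_of_le hA.le h2.le
    have h3 : ‖A - 3 + 4‖ < 1 / 2 := IsUltrametricDist.norm_add_lt_of_lt hA h4
    nlinarith [norm_nonneg (A - 3 + 2), norm_nonneg (A - 3 + 4)]
  | succ i ih =>
    rw [pow_succ 2 (i + 1), pow_mul]
    set B := A ^ 2 ^ (i + 1)
    rw [show B ^ 2 - 1 = (B - 1) * ((B - 1) + 2) by ring, norm_mul]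
    have h1 : ‖B - 1 + 2‖ ≤ 1 / 2 := by
      refine IsUltrametricDist.norm_add_le_of_le (ih.le.trans ?_) h2.le
      exact pow_le_of_le_one (by norm_num) (by norm_num) (by omega)
    rw [pow_succ _ (i + 2)]
    exact (mul_le_mul_of_nonneg_left h1 (norm_nonneg _)).trans_lt
      (mul_lt_mul_of_pos_right ih (by norm_num))

/-- If `A - 1` is `2t` up to smaller terms, then each squaring of `A` multiplies it by `2` up to
smaller terms. -/
theorem norm_pow_two_pow_sub_one_sub_lt (h2 : ‖(2 : L)‖ = 1 / 2) {A t : L} (ht : ‖t‖ < 1)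
    (hA : ‖A - 1 - 2 * t‖ < ‖t‖ / 2) (i : ℕ) :
    ‖A ^ 2 ^ i - 1 - 2 ^ (i + 1) * t‖ < (1 / 2) ^ (i + 1) * ‖t‖ := by
  induction i with
  | zero => simpa [div_eq_inv_mul] using hA
  | succ i ih =>
    rw [pow_succ 2 i, pow_mul]
    set B := A ^ 2 ^ i
    set E := B - 1 - 2 ^ (i + 1) * t with hE
    have hp : (0 : ℝ) < (1 / 2) ^ (i + 1) := by positivity
    have hp1 : (1 / 2 : ℝ) ^ (i + 1) ≤ 1 / 2 :=
      pow_le_of_le_one (by norm_num) (by norm_num) (by omega)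
    have ht0 : 0 < ‖t‖ := by linarith [norm_nonneg (A - 1 - 2 * t)]
    have hB : ‖B - 1‖ ≤ (1 / 2) ^ (i + 1) * ‖t‖ := by
      rw [show B - 1 = E + 2 ^ (i + 1) * t by rw [hE]; ring]
      exact IsUltrametricDist.norm_add_le_of_le ih.le (by rw [norm_mul, norm_pow, h2])
    rw [show B ^ 2 - 1 - 2 ^ (i + 1 + 1) * t = 2 * E + (B - 1) * (B - 1) by rw [hE]; ring]
    rw [pow_succ _ (i + 1)]
    refine IsUltrametricDist.norm_add_lt_of_lt ?_ ?_
    · rw [norm_mul, h2]; linarith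
    · rw [norm_mul]
      calc ‖B - 1‖ * ‖B - 1‖ ≤ ((1 / 2) ^ (i + 1) * ‖t‖) * ((1 / 2) ^ (i + 1) * ‖t‖) := by gcongr
        _ < _ := by
          rw [mul_right_comm _ (1 / 2 : ℝ)]
          refine mul_lt_mul_of_pos_left ?_ (by positivity)
          nlinarith

end Dyadic

/-! ### Roots of the shifted trinomial -/

section Trinomial

/-- The trinomial `x ^ n + a x + b` after the substitution `x ↦ x + 1`, which centres it at its
only root modulo `2` when `n` is a power of `2`, `a` is even and `b` is odd. -/
noncomputable def shiftedTrinomial (L : Type*) [Field L] (n : ℕ) (a b : ℤ) : L[X] :=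
  (X + C 1) ^ n + (C (a : L) * X + C ((a + b : ℤ) : L))

theorem shiftedTrinomial_monic {L : Type*} [Field L] {n : ℕ} (hn : 2 ≤ n) (a b : ℤ) :
    (shiftedTrinomial L n a b).Monic := by
  refine ((monic_X_add_C (1 : L)).pow n).add_of_left ?_
  rw [degree_pow, degree_X_add_C]
  refine (degree_linear_le).trans_lt ?_
  simp only [nsmul_eq_mul, mul_one]
  exact_mod_cast (by omega : 1 < n)

theorem shiftedTrinomial_eval {L : Type*} [Field L] (n : ℕ) (a b : ℤ) (t : L) :
    (shiftedTrinomial L n a b).eval t = ((1 + t) ^ n - 1) + (a * t + ((a + b + 1 : ℤ) : L)) := by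
  simp [shiftedTrinomial]
  ring

theorem shiftedTrinomial_coeff {L : Type*} [Field L] (n : ℕ) (a b : ℤ) {k : ℕ} (hk : 2 ≤ k) :
    (shiftedTrinomial L n a b).coeff k = (n.choose k : ℕ) := by
  obtain ⟨k, rfl⟩ := Nat.exists_eq_add_of_le' hk
  rw [shiftedTrinomial, coeff_add, coeff_add, coeff_C_mul, coeff_X_of_ne_one (by omega),
    coeff_C_of_ne_zero (by omega), C_1, coeff_X_add_one_pow]
  simp

variable {L : Type*} [NormedField L] [IsUltrametricDist L] [IsAlgClosed L]
variable {m s : ℕ} {a b : ℤ}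

theorem two_le_two_pow {m : ℕ} (hm : 1 ≤ m) : 2 ≤ 2 ^ m :=
  Nat.pow_le_pow_right (n := 2) two_pos hm

/-- The edges of the Newton polygon that join two consecutive powers of `2`. -/
theorem exists_root_shiftedTrinomial_pow (h2 : ‖(2 : L)‖ = 1 / 2) (hm : 1 ≤ m) (hs : 1 ≤ s)
    (ha : (2 : ℤ) ^ (s + 1) ∣ a) (hb : (2 : ℤ) ^ (s + 2) ∣ a + b + 1) :
    ∃ ρ : L, (shiftedTrinomial L (2 ^ (m + s)) a b).eval ρ = 0 ∧ ‖ρ‖ ^ 2 ^ m = 1 / 2 := by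
  obtain ⟨t, ht⟩ := IsAlgClosed.exists_pow_nat_eq (2 : L) (pow_pos two_pos m)
  have hτ : ‖t‖ ^ 2 ^ m = 1 / 2 := by rw [← norm_pow, ht, h2]
  have ht1 : ‖t‖ < 1 := by
    by_contra! h
    linarith [one_le_pow₀ h (n := 2 ^ m)]
  have hA : ‖(1 + t) ^ 2 ^ m - 3‖ < 1 / 2 := by
    have := norm_one_add_pow_two_pow_sub_le h2 ht1.le m
    rw [ht, sub_sub, show (1 : L) + 2 = 3 by norm_num] at this
    linarith
  obtain ⟨i, rfl⟩ := Nat.exists_eq_add_of_le' hs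
  have hpow := norm_pow_two_pow_sub_one_lt h2 hA i
  rw [← pow_mul, ← pow_add] at hpow
  obtain ⟨ρ, h0, hρ⟩ := exists_root_norm_eq (t := t) (k := 2 ^ m)
    (shiftedTrinomial_monic (L := L) (two_le_two_pow (by omega : 1 ≤ m + (i + 1))) a b) (by
      rw [shiftedTrinomial_coeff _ _ _ (two_le_two_pow hm), hτ, shiftedTrinomial_eval]
      refine lt_of_lt_of_le ?_
        (mul_le_mul_of_nonneg_right (pow_le_norm_choose_two_pow h2 m (i + 1)) (by norm_num))
      rw [← pow_succ]
      refine IsUltrametricDist.norm_add_lt_of_lt hpow (IsUltrametricDist.norm_add_lt_of_lt ?_ ?_)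
      · rw [norm_mul]
        calc ‖(a : L)‖ * ‖t‖ ≤ (1 / 2) ^ (i + 1 + 1) * ‖t‖ := by
              gcongr; exact norm_intCast_le_of_two_pow_dvd h2 ha
          _ < _ := mul_lt_of_lt_one_right (by positivity) ht1
      · exact (norm_intCast_le_of_two_pow_dvd h2 hb).trans_lt
          (pow_lt_pow_right_of_lt_one₀ (by norm_num) (by norm_num) (by omega)))
  exact ⟨ρ, h0, by rw [hρ, hτ]⟩

theorem half_lt_of_pow_eq_half {x : ℝ} (hx : 0 ≤ x) {d : ℕ} (hd : 2 ≤ d) (h : x ^ d = 1 / 2) :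
    1 / 2 < x ∧ x < 1 := by
  have h1 : x < 1 := by
    by_contra! h1
    linarith [one_le_pow₀ h1 (n := d)]
  have h0 : 0 < x := by
    refine hx.lt_of_ne ?_
    rintro rfl
    rw [zero_pow (by omega)] at h
    norm_num at h
  refine ⟨?_, h1⟩
  rw [← h]
  exact pow_lt_self_of_lt_one₀ h0 h1 (by omega)

/-- The edge of the Newton polygon that starts at the linear term. -/
theorem exists_root_shiftedTrinomial_pow_sub_one (h2 : ‖(2 : L)‖ = 1 / 2) (hm : 2 ≤ m)
    (ha : (2 : ℤ) ^ (s + 2) ∣ a + 2 ^ (s + 1)) (hb : (2 : ℤ) ^ (s + 2) ∣ a + b + 1) :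
    ∃ ρ : L, (shiftedTrinomial L (2 ^ (m + s)) a b).eval ρ = 0 ∧ ‖ρ‖ ^ (2 ^ m - 1) = 1 / 2 := by
  have h4 : 4 ≤ 2 ^ m := Nat.pow_le_pow_right (n := 2) two_pos hm
  obtain ⟨t, ht⟩ := IsAlgClosed.exists_pow_nat_eq (2 : L) (by omega : 0 < 2 ^ m - 1)
  have hτ : ‖t‖ ^ (2 ^ m - 1) = 1 / 2 := by rw [← norm_pow, ht, h2]
  obtain ⟨hlt, ht1⟩ := half_lt_of_pow_eq_half (norm_nonneg t) (by omega) hτ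
  have ht' : t ^ 2 ^ m = 2 * t := by
    rw [← ht, ← pow_succ, Nat.sub_add_cancel (by omega)]
  have hA : ‖(1 + t) ^ 2 ^ m - 1 - 2 * t‖ < ‖t‖ / 2 := by
    rw [← ht']
    exact norm_one_add_pow_two_pow_sub_lt h2 (by linarith) ht1 hm
  have hpow := norm_pow_two_pow_sub_one_sub_lt h2 ht1 hA s
  rw [← pow_mul, ← pow_add] at hpow
  have hp : (0 : ℝ) < (1 / 2) ^ (s + 1) := by positivity
  obtain ⟨ρ, h0, hρ⟩ := exists_root_norm_eq (t := t) (k := 2 ^ m)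
    (shiftedTrinomial_monic (L := L) (two_le_two_pow (by omega : 1 ≤ m + s)) a b) (by
      rw [shiftedTrinomial_coeff _ _ _ (two_le_two_pow (by omega)), ← norm_pow, ht', norm_mul, h2,
        shiftedTrinomial_eval]
      refine lt_of_lt_of_le ?_
        (mul_le_mul_of_nonneg_right (pow_le_norm_choose_two_pow h2 m s) (by positivity))
      rw [← mul_assoc, ← pow_succ]
      -- the leading terms `2 ^ (s + 1) * t` of the power and `a * t` cancel
      rw [show (1 + t) ^ 2 ^ (m + s) - 1 + (a * t + ((a + b + 1 : ℤ) : L)) =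
        ((1 + t) ^ 2 ^ (m + s) - 1 - 2 ^ (s + 1) * t) +
          (((a + 2 ^ (s + 1) : ℤ) : L) * t + ((a + b + 1 : ℤ) : L)) by push_cast; ring]
      refine IsUltrametricDist.norm_add_lt_of_lt hpow (IsUltrametricDist.norm_add_lt_of_lt ?_ ?_)
      · rw [norm_mul]
        have := norm_intCast_le_of_two_pow_dvd h2 ha
        gcongr
        exact this.trans_lt (pow_lt_pow_right_of_lt_one₀ (by norm_num) (by norm_num) (by omega))
      · have := norm_intCast_le_of_two_pow_dvd h2 hb
        rw [pow_succ] at this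
        nlinarith)
  exact ⟨ρ, h0, by rw [hρ, hτ]⟩

/-- The remaining edges of the Newton polygon, to the left of abscissa `2 ^ m`. The lower bound `1 / 4`
for `μ ^ 2 ^ m` lets the term of degree `2 ^ m` dominate the constant term, whose valuation is at
least `s + 2`. -/
theorem exists_root_shiftedTrinomial_lt (h2 : ‖(2 : L)‖ = 1 / 2) (hm : 1 ≤ m)
    (hb : (2 : ℤ) ^ (s + 2) ∣ a + b + 1) {μ : ℝ} (hμ : 0 ≤ μ) (h : 1 / 4 < μ ^ 2 ^ m) :
    ∃ ρ : L, (shiftedTrinomial L (2 ^ (m + s)) a b).eval ρ = 0 ∧ ‖ρ‖ < μ := by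
  refine exists_root_norm_lt (k := 2 ^ m)
    (shiftedTrinomial_monic (two_le_two_pow (by omega : 1 ≤ m + s)) a b) hμ ?_
  rw [shiftedTrinomial_coeff _ _ _ (two_le_two_pow hm), shiftedTrinomial_eval]
  simp only [add_zero, one_pow, sub_self, mul_zero, zero_add]
  have h1 := norm_intCast_le_of_two_pow_dvd h2 hb
  have h3 := pow_le_norm_choose_two_pow h2 m s
  have hp : (0 : ℝ) < (1 / 2) ^ s := by positivity
  calc _ ≤ _ := h1
    _ = (1 / 2) ^ s * (1 / 4) := by rw [pow_add]; norm_num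
    _ < (1 / 2) ^ s * μ ^ 2 ^ m := by gcongr
    _ ≤ _ := by gcongr

end Trinomial

/-! ### The prime ideal defined by an embedding into a nonarchimedean field -/

theorem norm_map_le_one_of_isIntegral {K L : Type*} [Field K] [NormedField L] [IsUltrametricDist L]
    (σ : K →+* L) {x : K} (hx : IsIntegral ℤ x) : ‖σ x‖ ≤ 1 := by
  have h1 : IsIntegral (NormedField.valuation (K := L)).integer (σ x) :=
    (hx.map σ.toIntAlgHom).tower_top
  exact (Valuation.integer.integers _).mem_of_integral h1

theorem norm_map_two {K L : Type*} [Field K] [NormedField L] (h2 : ‖(2 : L)‖ = 1 / 2) (σ : K →+* L) :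
    ‖σ ((2 : 𝓞 K) : K)‖ = 1 / 2 := by
  rw [show ((2 : 𝓞 K) : K) = 2 from map_ofNat (algebraMap (𝓞 K) K) 2, map_ofNat, h2]

section Centre

variable {K L : Type*} [Field K] [NormedField L] [IsUltrametricDist L]

/-- The centre, on the ring of integers of `K`, of the absolute value on `K` induced by an embedding
`σ` of `K` into a nonarchimedean normed field. -/
def centre (σ : K →+* L) : Ideal (𝓞 K) where
  carrier := {x | ‖σ x‖ < 1}
  add_mem' {x y} hx hy := by
    simpa using IsUltrametricDist.norm_add_lt_of_lt (x := σ x) (y := σ y) hx hy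
  zero_mem' := by simp
  smul_mem' c x hx := by
    have hc := norm_map_le_one_of_isIntegral σ c.isIntegral_coe
    simpa using mul_lt_one_of_nonneg_of_lt_one_right hc (norm_nonneg _) hx

theorem mem_centre {σ : K →+* L} {x : 𝓞 K} : x ∈ centre σ ↔ ‖σ x‖ < 1 := Iff.rfl

theorem notMem_centre {σ : K →+* L} {x : 𝓞 K} : x ∉ centre σ ↔ ‖σ x‖ = 1 := by
  rw [mem_centre, not_lt]
  exact (norm_map_le_one_of_isIntegral σ x.isIntegral_coe).ge_iff_eq'.trans eq_comm

instance centre_isPrime (σ : K →+* L) : (centre σ).IsPrime where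
  ne_top' := by simp [Ideal.ne_top_iff_one, mem_centre]
  mem_or_mem' {x y} h := by
    contrapose! h
    rw [notMem_centre, notMem_centre] at h
    simp [notMem_centre, h]

theorem two_mem_centre (h2 : ‖(2 : L)‖ = 1 / 2) (σ : K →+* L) : 2 ∈ centre σ := by
  rw [mem_centre, norm_map_two h2]
  norm_num

end Centre

/-- Any two elements of a Dedekind domain are comparable for divisibility locally at `P`. -/
theorem exists_mul_eq_mul_notMem {R : Type*} [CommRing R] [IsDedekindDomain R] {P : Ideal R}
    [P.IsPrime] (hP : P ≠ ⊥) (u v : R) : ∃ x y, u * x = v * y ∧ (x ∉ P ∨ y ∉ P) := by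
  have := IsLocalization.AtPrime.isDiscreteValuationRing_of_dedekind_domain R hP
    (Localization.AtPrime P)
  have key (u v : R) (c : Localization.AtPrime P) (hc : algebraMap R _ u * c = algebraMap R _ v) :
      ∃ x y, u * x = v * y ∧ y ∉ P := by
    obtain ⟨x, y, rfl⟩ := IsLocalization.exists_mk'_eq P.primeCompl c
    refine ⟨x, y, ?_, y.2⟩
    rw [IsLocalization.mul_mk'_eq_mk'_of_mul, IsLocalization.mk'_eq_iff_eq_mul, ← map_mul] at hc
    exact IsLocalization.injective _ P.primeCompl_le_nonZeroDivisors hc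
  obtain ⟨c, hc | hc⟩ := ValuationRing.cond (algebraMap R (Localization.AtPrime P) u)
    (algebraMap R (Localization.AtPrime P) v)
  · obtain ⟨x, y, h, hy⟩ := key u v c hc
    exact ⟨x, y, h, Or.inr hy⟩
  · obtain ⟨x, y, h, hy⟩ := key v u c hc
    exact ⟨y, x, h.symm, Or.inl hy⟩

section Slope

variable {K L : Type*} [Field K] [NumberField K] [NormedField L] [IsUltrametricDist L]

theorem centre_ne_bot (h2 : ‖(2 : L)‖ = 1 / 2) (σ : K →+* L) : centre σ ≠ ⊥ := by
  intro h
  have := two_mem_centre h2 σ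
  rw [h, Ideal.mem_bot] at this
  exact two_ne_zero this

/-- If `α ^ d / 2` is a unit for an absolute value, then it is a unit at its centre. -/
theorem exists_pow_mul_eq_two_mul (h2 : ‖(2 : L)‖ = 1 / 2) {σ : K →+* L} {α : 𝓞 K} {d : ℕ}
    (h : ‖σ α‖ ^ d = 1 / 2) : ∃ x y, α ^ d * x = 2 * y ∧ x ∉ centre σ ∧ y ∉ centre σ := by
  obtain ⟨x, y, hxy, hor⟩ := exists_mul_eq_mul_notMem (centre_ne_bot h2 σ) (α ^ d) 2
  have hn : ‖σ x‖ = ‖σ y‖ := by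
    have := congrArg (fun z : 𝓞 K => ‖σ z‖) hxy
    simp only [map_mul, map_pow, norm_mul, norm_pow, h, norm_map_two h2] at this
    linarith
  refine ⟨x, y, hxy, ?_⟩
  rw [notMem_centre, notMem_centre, hn, or_self] at hor
  rw [notMem_centre, notMem_centre, hn]
  exact ⟨hor, hor⟩

/-- The centre has ramification index at least `d` over `2`. -/
theorem two_mem_centre_pow (h2 : ‖(2 : L)‖ = 1 / 2) {σ : K →+* L} {α : 𝓞 K} {d : ℕ}
    (h : ‖σ α‖ ^ d = 1 / 2) : 2 ∈ centre σ ^ d := by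
  obtain ⟨x, y, hxy, -, hy⟩ := exists_pow_mul_eq_two_mul h2 h
  have hα : α ∈ centre σ := by
    rw [mem_centre]
    by_contra! h1
    linarith [one_le_pow₀ h1 (n := d)]
  have h2y : 2 * y ∈ centre σ ^ d := hxy ▸ Ideal.mul_mem_right _ _ (Ideal.pow_mem_pow hα d)
  have : (centre σ).IsMaximal := (centre_isPrime σ).isMaximal (centre_ne_bot h2 σ)
  rw [mul_comm] at h2y
  exact (Ideal.IsPrime.mul_mem_pow (centre σ) h2y).resolve_left hy

/-- Absolute values with the same centre agree at `α`, as both see that `α ^ d / 2` is a unit. -/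
theorem norm_eq_of_centre_eq (h2 : ‖(2 : L)‖ = 1 / 2) {σ τ : K →+* L} {α : 𝓞 K} {d : ℕ}
    (hd : d ≠ 0) (h : ‖σ α‖ ^ d = 1 / 2) (hc : centre σ = centre τ) : ‖σ α‖ = ‖τ α‖ := by
  obtain ⟨x, y, hxy, hx, hy⟩ := exists_pow_mul_eq_two_mul h2 h
  rw [hc, notMem_centre] at hx hy
  have := congrArg (fun z : 𝓞 K => ‖τ z‖) hxy
  simp only [map_mul, map_pow, norm_mul, norm_pow, hx, hy, mul_one] at this
  refine (pow_left_inj₀ (norm_nonneg _) (norm_nonneg _) hd).mp ?_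
  rw [h, this, norm_map_two h2]

end Slope

/-! ### Primes of norm two -/

/-- A form of `∑ eᵢ fᵢ ≤ n`: if `eᵢ ≥ dᵢ` and there is no room for `fᵢ ≥ 2`, then `fᵢ = 1`. -/
theorem absNorm_eq_two {R : Type*} [CommRing R] [IsDedekindDomain R] [Module.Free ℤ R]
    [Module.Finite ℤ R] {ι : Type*} [Fintype ι] {P : ι → Ideal R}
    (hprime : ∀ i, (P i).IsPrime) (hbot : ∀ i, P i ≠ ⊥) (hinj : Function.Injective P) {d : ι → ℕ}
    (hd : ∀ i, 2 ∈ P i ^ d i) (i₀ : ι) (hi₀ : d i₀ ≠ 0)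
    (hn : Module.finrank ℤ R < ∑ i, d i + d i₀) :
    Ideal.absNorm (P i₀) = 2 := by
  classical
  have hdvd : ∏ i, P i ^ d i ∣ Ideal.span {2} := by
    refine Finset.prod_dvd_of_coprime (fun i _ j _ hij => IsCoprime.pow ?_) fun i _ => ?_
    · rw [Ideal.isCoprime_iff_sup_eq]
      exact ((hprime i).isMaximal (hbot i)).coprime_of_ne ((hprime j).isMaximal (hbot j))
        (hinj.ne hij)
    · rw [Ideal.dvd_span_singleton]
      exact hd i
  have hnorm : Ideal.absNorm (Ideal.span {(2 : R)}) = 2 ^ Module.finrank ℤ R := by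
    rw [Ideal.absNorm_span_singleton, show (2 : R) = algebraMap ℤ R 2 by simp,
      Algebra.norm_algebraMap, Int.natAbs_pow]
    rfl
  have hle := map_dvd Ideal.absNorm hdvd
  rw [hnorm, map_prod] at hle
  simp only [map_pow] at hle
  have htwo (i : ι) : 2 ≤ Ideal.absNorm (P i) := by
    have h1 : Ideal.absNorm (P i) ≠ 1 := by
      rw [Ne, Ideal.absNorm_eq_one_iff]
      exact (hprime i).ne_top
    have h0 : Ideal.absNorm (P i) ≠ 0 := by
      rw [Ne, Ideal.absNorm_eq_zero_iff]
      exact hbot i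
    omega
  -- the norm of `P i₀` is a power of `2`, so it is at least `4` if it is not `2`
  have hpow : Ideal.absNorm (P i₀) ∣ 2 ^ Module.finrank ℤ R :=
    (dvd_pow_self _ hi₀).trans ((Finset.dvd_prod_of_mem _ (Finset.mem_univ i₀)).trans hle)
  obtain ⟨k, -, hk⟩ := (Nat.dvd_prime_pow Nat.prime_two).mp hpow
  by_contra hne
  have h4 : 2 * 2 ≤ Ideal.absNorm (P i₀) := by
    have := htwo i₀
    rcases k with _ | _ | k
    · rw [pow_zero] at hk; omega
    · rw [zero_add, pow_one] at hk; omega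
    · rw [hk, pow_succ, pow_succ]
      have := Nat.one_le_two_pow (n := k)
      omega
  have hprod : ∏ i, 2 ^ (d i + if i = i₀ then d i₀ else 0) ≤ ∏ i, Ideal.absNorm (P i) ^ d i := by
    refine Finset.prod_le_prod' fun i _ => ?_
    split_ifs with h
    · subst h
      rw [pow_add, ← mul_pow]
      exact Nat.pow_le_pow_left h4 _
    · exact Nat.pow_le_pow_left (htwo i) _
  rw [Finset.prod_pow_eq_pow_sum, Finset.sum_add_distrib, Finset.sum_ite_eq' Finset.univ i₀] at hprod
  simp only [Finset.mem_univ, if_true] at hprod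
  have := hprod.trans (Nat.le_of_dvd (by positivity) hle)
  have := (Nat.pow_le_pow_iff_right (by norm_num : 1 < 2)).mp this
  omega

theorem mem_or_sub_one_mem_of_absNorm_eq_two {R : Type*} [CommRing R] [IsDedekindDomain R]
    [Module.Free ℤ R] {P : Ideal R} (h : Ideal.absNorm P = 2) (x : R) : x ∈ P ∨ x - 1 ∈ P := by
  rw [Ideal.absNorm_apply, Submodule.cardQuot_apply, Nat.card_eq_two_iff' 0] at h
  have h1 : (Ideal.Quotient.mk P 1) ≠ 0 := by
    intro h1
    obtain ⟨y, hy, -⟩ := h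
    have hall (z : R ⧸ P) : z = 0 := by
      rw [← mul_one z, ← map_one (Ideal.Quotient.mk P), h1, mul_zero]
    exact hy (hall y)
  by_cases hx : Ideal.Quotient.mk P x = 0
  · exact Or.inl (Ideal.Quotient.eq_zero_iff_mem.mp hx)
  · exact Or.inr (Ideal.Quotient.eq.mp (h.unique hx h1))

/-- Three primes with residue field `𝔽₂` prevent an element from generating a subring of odd index,
since an element has only two possible residues. -/
theorem two_dvd_index_adjoin {R : Type*} [CommRing R] [IsDedekindDomain R] [Module.Free ℤ R]
    {P : Fin 3 → Ideal R} (hinj : Function.Injective P) (h : ∀ i, Ideal.absNorm (P i) = 2) (η : R) :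
    2 ∣ (Subalgebra.toSubmodule (Algebra.adjoin ℤ {η})).toAddSubgroup.index := by
  by_contra hodd
  set m := (Subalgebra.toSubmodule (Algebra.adjoin ℤ {η})).toAddSubgroup.index with hm
  have hint (i : Fin 3) (c : ℤ) : (c : R) ∈ P i ↔ Even c := by
    have htwo : (2 : R) ∈ P i := by
      have := Ideal.absNorm_mem (P i)
      rw [h i] at this
      exact_mod_cast this
    have hone : (1 : R) ∉ P i := by
      rw [← Ideal.eq_top_iff_one, ← Ideal.absNorm_eq_one_iff, h i]
      norm_num
    obtain ⟨q, rfl | rfl⟩ := Int.even_or_odd' c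
    · simpa using Ideal.mul_mem_right _ _ htwo
    · push_cast
      rw [(P i).add_mem_iff_right (Ideal.mul_mem_right _ _ htwo)]
      simp [hone]
  have key (i j : Fin 3) (c : ℤ) (hi : η - c ∈ P i) (hj : η - c ∈ P j) : P i ≤ P j := by
    -- every element of `ℤ[η]` is congruent to the same integer at both primes
    have hadj : ∀ x ∈ Algebra.adjoin ℤ {η}, ∃ c : ℤ, x - c ∈ P i ⊓ P j := by
      intro x hx
      induction hx using Algebra.adjoin_induction with
      | mem x hx =>
        obtain rfl := Set.mem_singleton_iff.mp hx
        exact ⟨c, hi, hj⟩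
      | algebraMap c => exact ⟨c, by simp⟩
      | add x y _ _ hx hy =>
        obtain ⟨u, hu⟩ := hx
        obtain ⟨v, hv⟩ := hy
        refine ⟨u + v, ?_⟩
        convert add_mem hu hv using 1
        push_cast
        ring
      | mul x y _ _ hx hy =>
        obtain ⟨u, hu⟩ := hx
        obtain ⟨v, hv⟩ := hy
        refine ⟨u * v, ?_⟩
        convert add_mem (Ideal.mul_mem_right y _ hu) (Ideal.mul_mem_left _ (u : R) hv) using 1
        push_cast
        ring
    intro x hx
    obtain ⟨c, hci, hcj⟩ := hadj _ (AddSubgroup.nsmul_index_mem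
      (Subalgebra.toSubmodule (Algebra.adjoin ℤ {η})).toAddSubgroup x)
    rw [← hm, nsmul_eq_mul] at hci hcj
    have hc : (c : R) ∈ P i :=
      ((P i).sub_mem_iff_right (Ideal.mul_mem_left _ _ hx)).mp hci
    have hcj' : (c : R) ∈ P j := (hint j c).mpr ((hint i c).mp hc)
    have hmx : (m : R) * x ∈ P j := ((P j).sub_mem_iff_left hcj').mp hcj
    have hm' : (m : R) ∉ P j := by
      have := hint j m
      rw [Int.cast_natCast, Int.even_coe_nat, even_iff_two_dvd] at this
      rwa [this]
    rcases mem_or_sub_one_mem_of_absNorm_eq_two (h j) x with hxj | hxj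
    · exact hxj
    · refine absurd ?_ hm'
      have := (P j).sub_mem hmx (Ideal.mul_mem_left _ (m : R) hxj)
      convert this using 1
      ring
  classical
  obtain ⟨i, j, hij, hres⟩ := Fintype.exists_ne_map_eq_of_card_lt
    (fun i : Fin 3 => decide (η ∈ P i)) (by simp)
  have hη : η ∈ P i ↔ η ∈ P j := by simpa using hres
  refine hij (hinj ?_)
  rcases mem_or_sub_one_mem_of_absNorm_eq_two (h i) η with hi | hi
  · exact le_antisymm (key i j 0 (by simpa using hi) (by simpa using hη.mp hi))
      (key j i 0 (by simpa using hη.mp hi) (by simpa using hi))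
  · have hj : η - 1 ∈ P j := by
      refine (mem_or_sub_one_mem_of_absNorm_eq_two (h j) η).resolve_left fun hj => ?_
      have := (P i).sub_mem (hη.mpr hj) hi
      rw [sub_sub_cancel] at this
      have h1 := hint i 1
      simp [this] at h1
    exact le_antisymm (key i j 1 (by simpa using hi) (by simpa using hj))
      (key j i 1 (by simpa using hj) (by simpa using hi))

/-! ### Number fields in which `2` is a common index divisor -/

theorem isCommonIndexDivisor_two_of_absNorm {K : Type*} [Field K] [NumberField K]
    {P : Fin 3 → Ideal (𝓞 K)} (hinj : Function.Injective P) (h : ∀ i, Ideal.absNorm (P i) = 2) :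
    IsCommonIndexDivisor 2 K ∧ ¬ IsMonogenic K := by
  refine ⟨⟨Nat.prime_two, (dvd_setGcd_iff _ _).mpr ?_⟩, ?_⟩
  · rintro _ ⟨η, -, rfl⟩
    exact two_dvd_index_adjoin hinj h η
  · rintro ⟨η, hη⟩
    have := two_dvd_index_adjoin hinj h η
    rw [hη] at this
    simp at this

theorem lt_of_pow_eq_half {x y : ℝ} (hx : 0 ≤ x) {d e : ℕ} (he : e ≠ 0) (hed : e < d)
    (hxd : x ^ d = 1 / 2) (hye : y ^ e = 1 / 2) : y < x := by
  by_contra! hle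
  have hx2 := half_lt_of_pow_eq_half hx (by omega) hxd
  have h1 : x ^ d < x ^ e := pow_lt_pow_right_of_lt_one₀ (by linarith) hx2.2 hed
  have h3 : x ^ e ≤ y ^ e := by gcongr
  linarith

section Embeddings

variable {K L : Type*} [Field K] [NumberField K] [NormedField L] [IsUltrametricDist L]

/-- Absolute values of a number field with distinct slopes at `α` have distinct centres. All of them
but the one of largest slope are required to have a slope of the form `1 / d`, which forces
ramification at least `d`; when that leaves no room for a residue extension at the first three,
there are three primes of norm two. -/
theorem isCommonIndexDivisor_two_of_embeddings (h2 : ‖(2 : L)‖ = 1 / 2) {k : ℕ}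
    (σ : Fin (k + 3) → K →+* L) (α : 𝓞 K) (hα : StrictAnti fun i => ‖σ i α‖) (d : Fin (k + 3) → ℕ)
    (hd : ∀ i, d i ≠ 0) (hpow : ∀ i, i ≠ Fin.last _ → ‖σ i α‖ ^ d i = 1 / 2)
    (hlast : d (Fin.last _) = 1)
    (hn : ∀ i : Fin 3, Module.finrank ℚ K < ∑ j, d j + d (i.castLE (by omega))) :
    IsCommonIndexDivisor 2 K ∧ ¬ IsMonogenic K := by
  have hne {i j : Fin (k + 3)} (hij : i < j) : centre (σ i) ≠ centre (σ j) := fun hc =>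
    (hα hij).ne' (norm_eq_of_centre_eq h2 (hd i) (hpow i (hij.trans_le (Fin.le_last j)).ne) hc)
  have hinj : Function.Injective fun i => centre (σ i) := by
    intro i j hc
    rcases lt_trichotomy i j with h | h | h
    · exact absurd hc (hne h)
    · exact h
    · exact absurd hc.symm (hne h)
  have hmem (i) : 2 ∈ centre (σ i) ^ d i := by
    by_cases hi : i = Fin.last _
    · rw [hi, hlast, pow_one]
      exact two_mem_centre h2 _
    · exact two_mem_centre_pow h2 (hpow i hi)
  refine isCommonIndexDivisor_two_of_absNorm (P := fun i : Fin 3 => centre (σ (i.castLE (by omega))))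
    (hinj.comp (Fin.castLE_injective (by omega))) fun i => ?_
  refine absNorm_eq_two (P := fun i => centre (σ i)) (fun i => centre_isPrime _)
    (fun i => centre_ne_bot h2 _) hinj hmem (i.castLE (by omega)) (hd _) ?_
  rw [RingOfIntegers.rank]
  exact hn i

end Embeddings

section Roots

variable {n : ℕ} {a b : ℤ} {K : Type*} [Field K] [NumberField K] {θ : K}

theorem trinomial_monic (hn : 2 ≤ n) (a b : ℤ) : (X ^ n + C a * X + C b : ℤ[X]).Monic := by
  rw [add_assoc]
  refine (monic_X_pow n).add_of_left ?_
  rw [degree_X_pow]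
  refine degree_linear_le.trans_lt ?_
  exact_mod_cast (by omega : 1 < n)

theorem minpoly_trinomial_root (hn : 2 ≤ n) (hF : Irreducible (X ^ n + C a * X + C b : ℤ[X]))
    (hθ : aeval θ (X ^ n + C a * X + C b : ℤ[X]) = 0) :
    minpoly ℚ θ = (X ^ n + C a * X + C b : ℤ[X]).map (algebraMap ℤ ℚ) := by
  have hm := trinomial_monic hn a b
  refine (minpoly.eq_of_irreducible_of_monic
    (hm.irreducible_iff_irreducible_map_fraction_map.mp hF) ?_ (hm.map _)).symm
  rwa [aeval_map_algebraMap]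

theorem finrank_of_trinomial_root (hn : 2 ≤ n) (hF : Irreducible (X ^ n + C a * X + C b : ℤ[X]))
    (hθ : aeval θ (X ^ n + C a * X + C b : ℤ[X]) = 0) (hK : IntermediateField.adjoin ℚ {θ} = ⊤) :
    Module.finrank ℚ K = n := by
  have h1 := IntermediateField.adjoin.finrank (K := ℚ) (Algebra.IsIntegral.isIntegral θ)
  rw [hK, IntermediateField.finrank_top', minpoly_trinomial_root hn hF hθ,
    (trinomial_monic hn a b).natDegree_map] at h1
  rw [h1, add_assoc, natDegree_add_eq_left_of_degree_lt, natDegree_X_pow]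
  rw [degree_X_pow]
  refine degree_linear_le.trans_lt ?_
  exact_mod_cast (by omega : 1 < n)

theorem exists_embedding_of_root {L : Type*} [Field L] [CharZero L] [IsAlgClosed L] (hn : 2 ≤ n)
    (hF : Irreducible (X ^ n + C a * X + C b : ℤ[X]))
    (hθ : aeval θ (X ^ n + C a * X + C b : ℤ[X]) = 0) (hK : IntermediateField.adjoin ℚ {θ} = ⊤)
    {ρ : L} (hρ : (shiftedTrinomial L n a b).eval ρ = 0) : ∃ σ : K →+* L, σ (θ - 1) = ρ := by
  obtain ⟨φ, hφ⟩ := IntermediateField.exists_algHom_of_adjoin_splits_of_aeval (F := ℚ) (E := K)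
    (K := L) (S := {θ}) (x := θ) (y := ρ + 1)
    (fun s _ => ⟨Algebra.IsIntegral.isIntegral s, IsAlgClosed.splits _⟩) hK (by
      rw [minpoly_trinomial_root hn hF hθ, aeval_map_algebraMap]
      rw [shiftedTrinomial_eval] at hρ
      push_cast at hρ
      simp only [map_add, map_mul, map_pow, aeval_X, eq_intCast, map_intCast]
      linear_combination hρ)
  exact ⟨φ, by simp [hφ]⟩

/-- The conclusion in terms of roots of `F(x + 1)`. The last root only serves to take up one unit of
the degree, so nothing but an upper bound for its absolute value is known. -/
theorem isCommonIndexDivisor_two_of_roots {L : Type*} [NormedField L] [CharZero L]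
    [IsUltrametricDist L] [IsAlgClosed L] (h2 : ‖(2 : L)‖ = 1 / 2) (hn : 2 ≤ n)
    (hF : Irreducible (X ^ n + C a * X + C b : ℤ[X]))
    (hθ : aeval θ (X ^ n + C a * X + C b : ℤ[X]) = 0) (hK : IntermediateField.adjoin ℚ {θ} = ⊤)
    {k : ℕ} (ρ : Fin (k + 3) → L) (hρ : ∀ i, (shiftedTrinomial L n a b).eval (ρ i) = 0)
    (hanti : StrictAnti fun i => ‖ρ i‖) (d : Fin (k + 3) → ℕ)
    (hd : ∀ i, d i ≠ 0) (hpow : ∀ i, i ≠ Fin.last _ → ‖ρ i‖ ^ d i = 1 / 2)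
    (hlast : d (Fin.last _) = 1)
    (hsum : ∀ i : Fin 3, n < ∑ j, d j + d (i.castLE (by omega))) :
    IsCommonIndexDivisor 2 K ∧ ¬ IsMonogenic K := by
  choose σ hσ using fun i => exists_embedding_of_root hn hF hθ hK (hρ i)
  have hint : IsIntegral ℤ θ := ⟨_, trinomial_monic hn a b, hθ⟩
  obtain ⟨α, hα⟩ : ∃ α : 𝓞 K, (α : K) = θ - 1 := ⟨⟨θ - 1, hint.sub isIntegral_one⟩, rfl⟩
  have hval (i) : σ i α = ρ i := by rw [hα, hσ]
  refine isCommonIndexDivisor_two_of_embeddings h2 σ α ?_ d hd ?_ hlast ?_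
  · simpa only [hval] using hanti
  · simpa only [hval] using hpow
  · rwa [finrank_of_trinomial_root hn hF hθ hK]

end Roots

theorem PadicAlgCl.norm_two : ‖(2 : PadicAlgCl 2)‖ = 1 / 2 := by
  have h := PadicAlgCl.norm_extends 2 (2 : ℚ_[2])
  rw [map_ofNat] at h
  have h1 := Padic.norm_p (p := 2)
  push_cast at h1
  rw [h, h1, one_div]

theorem theorem2p5 (r : ℕ) (a b : ℤ)
    (hF : Irreducible (X ^ (2 ^ r) + C a * X + C b : ℤ[X]))
    (K : Type*) [Field K] [NumberField K] (θ : K)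
    (hθ : aeval θ (X ^ (2 ^ r) + C a * X + C b : ℤ[X]) = 0)
    (hK : IntermediateField.adjoin ℚ {θ} = ⊤)
    (h : (3 ≤ r ∧ a ≡ 4 [ZMOD 8] ∧ b ≡ 3 [ZMOD 8]) ∨
      (4 ≤ r ∧ a ≡ 8 [ZMOD 16] ∧ b ≡ 7 [ZMOD 16]) ∨
      (4 ≤ r ∧ ((a ≡ 0 [ZMOD 32] ∧ b ≡ 31 [ZMOD 32]) ∨
        (a ≡ 16 [ZMOD 32] ∧ b ≡ 15 [ZMOD 32])))) :
    IsCommonIndexDivisor 2 K ∧ ¬ IsMonogenic K := by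
  have h2 := PadicAlgCl.norm_two
  simp only [Int.ModEq] at h
  rcases h with ⟨hr, ha, hb⟩ | ⟨hr, ha, hb⟩ | ⟨hr, hab⟩
  -- edges of widths `2 ^ (r - 1)`, `2 ^ (r - 1) - 1` and `1`
  · obtain ⟨m, rfl⟩ := Nat.exists_eq_add_of_le' (by omega : 1 ≤ r)
    have hm4 : 4 ≤ 2 ^ m := Nat.pow_le_pow_right (n := 2) two_pos (by omega : 2 ≤ m)
    obtain ⟨ρ₀, h₀, e₀⟩ := exists_root_shiftedTrinomial_pow (m := m) (s := 1) (a := a) (b := b) h2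
      (by omega) le_rfl (by omega) (by omega)
    obtain ⟨ρ₁, h₁, e₁⟩ := exists_root_shiftedTrinomial_pow_sub_one (m := m) (s := 1) (a := a)
      (b := b) h2 (by omega) (by omega) (by omega)
    have hlt₁ := half_lt_of_pow_eq_half (norm_nonneg ρ₁) (by omega) e₁
    obtain ⟨ρ₂, h₂, e₂⟩ := exists_root_shiftedTrinomial_lt (m := m) (s := 1) (a := a) (b := b) h2
      (by omega) (by omega) (norm_nonneg ρ₁) (by
        rw [← Nat.sub_add_cancel (by omega : 1 ≤ 2 ^ m), pow_succ, e₁]; linarith)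
    have hpow1 : 2 ^ (m + 1) = 2 ^ m * 2 := pow_succ 2 m
    refine isCommonIndexDivisor_two_of_roots (k := 0) h2 (two_le_two_pow (by omega)) hF hθ hK
      ![ρ₀, ρ₁, ρ₂] (by simp [Fin.forall_fin_succ, h₀, h₁, h₂])
      (Fin.strictAnti_iff_succ_lt.mpr ?_) ![2 ^ m, 2 ^ m - 1, 1] ?_ ?_ rfl ?_
    · have := lt_of_pow_eq_half (norm_nonneg ρ₀) (by omega) (by omega) e₀ e₁
      simp [Fin.forall_fin_succ, this, e₂]
    · simp [Fin.forall_fin_succ]; omega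
    · simp only [Fin.forall_fin_succ]
      simp [e₀, e₁]
    · simp only [Fin.forall_fin_succ]
      simp [Fin.sum_univ_succ]
      omega
  -- edges of widths `2 ^ (r - 1)`, `2 ^ (r - 2)`, `2 ^ (r - 2) - 1` and `1`
  · obtain ⟨m, rfl⟩ := Nat.exists_eq_add_of_le' (by omega : 2 ≤ r)
    have hm4 : 4 ≤ 2 ^ m := Nat.pow_le_pow_right (n := 2) two_pos (by omega : 2 ≤ m)
    obtain ⟨ρ₀, h₀, e₀⟩ := exists_root_shiftedTrinomial_pow (m := m + 1) (s := 1) (a := a) (b := b)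
      h2 (by omega) le_rfl (by omega) (by omega)
    obtain ⟨ρ₁, h₁, e₁⟩ := exists_root_shiftedTrinomial_pow (m := m) (s := 2) (a := a) (b := b) h2
      (by omega) (by omega) (by omega) (by omega)
    obtain ⟨ρ₂, h₂, e₂⟩ := exists_root_shiftedTrinomial_pow_sub_one (m := m) (s := 2) (a := a)
      (b := b) h2 (by omega) (by omega) (by omega)
    have hlt₂ := half_lt_of_pow_eq_half (norm_nonneg ρ₂) (by omega) e₂
    obtain ⟨ρ₃, h₃, e₃⟩ := exists_root_shiftedTrinomial_lt (m := m) (s := 2) (a := a) (b := b) h2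
      (by omega) (by omega) (norm_nonneg ρ₂) (by
        rw [← Nat.sub_add_cancel (by omega : 1 ≤ 2 ^ m), pow_succ, e₂]; linarith)
    have hpow1 : 2 ^ (m + 1) = 2 ^ m * 2 := pow_succ 2 m
    have hpow2 : 2 ^ (m + 2) = 2 ^ m * 4 := pow_add 2 m 2
    refine isCommonIndexDivisor_two_of_roots (k := 1) h2 (two_le_two_pow (by omega)) hF hθ hK
      ![ρ₀, ρ₁, ρ₂, ρ₃] (by simp [Fin.forall_fin_succ, h₀, h₁, h₂, h₃])
      (Fin.strictAnti_iff_succ_lt.mpr ?_) ![2 ^ (m + 1), 2 ^ m, 2 ^ m - 1, 1] ?_ ?_ rfl ?_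
    · have h01 := lt_of_pow_eq_half (norm_nonneg ρ₀) (by omega) (by omega) e₀ e₁
      have h12 := lt_of_pow_eq_half (norm_nonneg ρ₁) (by omega) (by omega) e₁ e₂
      simp [Fin.forall_fin_succ, h01, h12, e₃]
    · simp [Fin.forall_fin_succ]; omega
    · simp only [Fin.forall_fin_succ]
      simp [e₀, e₁, e₂]
    · simp only [Fin.forall_fin_succ]
      simp [Fin.sum_univ_succ]
      omega
  -- edges of widths `2 ^ (r - 1)`, `2 ^ (r - 2)`, `2 ^ (r - 3)`, and at least one more to their left
  · obtain ⟨m, rfl⟩ := Nat.exists_eq_add_of_le' (by omega : 3 ≤ r)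
    have hm2 : 2 ≤ 2 ^ m := two_le_two_pow (by omega)
    obtain ⟨ρ₀, h₀, e₀⟩ := exists_root_shiftedTrinomial_pow (m := m + 2) (s := 1) (a := a) (b := b)
      h2 (by omega) le_rfl (by omega) (by omega)
    obtain ⟨ρ₁, h₁, e₁⟩ := exists_root_shiftedTrinomial_pow (m := m + 1) (s := 2) (a := a) (b := b)
      h2 (by omega) (by omega) (by omega) (by omega)
    obtain ⟨ρ₂, h₂, e₂⟩ := exists_root_shiftedTrinomial_pow (m := m) (s := 3) (a := a) (b := b) h2
      (by omega) (by omega) (by omega) (by omega)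
    obtain ⟨ρ₃, h₃, e₃⟩ := exists_root_shiftedTrinomial_lt (m := m) (s := 3) (a := a) (b := b) h2
      (by omega) (by omega) (norm_nonneg ρ₂) (by rw [e₂]; norm_num)
    have hpow1 : 2 ^ (m + 1) = 2 ^ m * 2 := pow_succ 2 m
    have hpow2 : 2 ^ (m + 2) = 2 ^ m * 4 := pow_add 2 m 2
    have hpow3 : 2 ^ (m + 3) = 2 ^ m * 8 := pow_add 2 m 3
    refine isCommonIndexDivisor_two_of_roots (k := 1) h2 (two_le_two_pow (by omega)) hF hθ hK
      ![ρ₀, ρ₁, ρ₂, ρ₃] (by simp [Fin.forall_fin_succ, h₀, h₁, h₂, h₃])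
      (Fin.strictAnti_iff_succ_lt.mpr ?_) ![2 ^ (m + 2), 2 ^ (m + 1), 2 ^ m, 1] ?_ ?_ rfl ?_
    · have h01 := lt_of_pow_eq_half (norm_nonneg ρ₀) (by omega) (by omega) e₀ e₁
      have h12 := lt_of_pow_eq_half (norm_nonneg ρ₁) (by omega) (by omega) e₁ e₂
      simp [Fin.forall_fin_succ, h01, h12, e₃]
    · simp [Fin.forall_fin_succ]
    · simp only [Fin.forall_fin_succ]
      simp [e₀, e₁, e₂]
    · simp only [Fin.forall_fin_succ]
      simp [Fin.sum_univ_succ]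
      omega
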